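/- Let $G$ be a finite group and let $R$ be a $G$-Tambara functor, i.e. a family of commutative rings $R(X)$, one for each finite $G$-set $X$, with restrictions, transfers and norms along all maps of finite $G$-sets, satisfying the usual axioms (functoriality, $R(X\sqcup Y)\cong R(X)\times R(Y)$ and $R(\emptyset)=0$, base change of transfers and norms along pullback squares, and the distributive law for exponential diagrams). A Tambara ideal $I$ of $R$ is a family of ideals $I(X)\subseteq R(X)$ that is closed under restrictions and transfers and satisfies $\mathrm{Nm}_f(a)-\mathrm{Nm}_f(0)\in I(Y)$ for every $f\colon X\to Y$ and $a\in I(X)$ (equivalently, a family of ideals $I(G/K)\subseteq R(G/K)$, $K\le G$, closed under restrictions, transfers, norms and conjugations). The product $I\cdot J$ is the Tambara ideal generated by the levelwise products $I(X)\cdot J(X)$. A Tambara ideal $\mathfrak p\neq R$ is prime if $I\cdot J\subseteq\mathfrak p$ implies $I\subseteq\mathfrak p$ or $J\subseteq\mathfrak p$. The Nakaoka spectrum $\mathrm{Spec}(R)$ is the set of prime Tambara ideals of $R$, with the topology whose closed sets are generated by the sets $V(I)=\{\mathfrak p : I\subseteq\mathfrak p\}$, for $I$ a Tambara ideal. $R$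 is called domain-like if its zero ideal is prime. For a subgroup $H\le G$, let $\mathrm{Res}_H^G R$ be the $H$-Tambara functor $X\mapsto R(G\times_H X)$, and for an $H$-Tambara functor $S$ let $\mathrm{CoInd}_H^G S$ be the $G$-Tambara functor $X\mapsto S(X|_H)$. The $H$-th stratum of $\mathrm{Spec}(R)$ is the image of the map $\mathrm{Spec}(\mathrm{Res}_H^G R)\to\mathrm{Spec}(R)$ that sends $\mathfrak q$ to the contraction of $\mathrm{CoInd}_H^G\mathfrak q$ along the adjunction unit $R\to\mathrm{CoInd}_H^G\mathrm{Res}_H^G R$, which at level $X$ is the restriction along $G\times_H X\to X$, $[g,x]\mapsto gx$. Suppose that $R$ is domain-like and that $H\le G$ is a subgroup for which the restriction $R(G/G)\to R(G/H)$ is not injective. Then the $H$-th stratum is not an open subset of $\mathrm{Spec}(R)$. -/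

import Mathlib

universe u v w

set_option linter.unusedVariables false

/-- A finite (left) `G`-set. Morphisms are Mathlib's equivariant maps `X →[G] Y`. -/
structure FinGSet (G : Type u) [Group G] where
  carrier : Type u
  [action : MulAction G carrier]
  [finite : Finite carrier]

namespace FinGSet

instance (G : Type u) [Group G] : CoeSort (FinGSet G) (Type u) := ⟨FinGSet.carrier⟩

attribute [instance] FinGSet.action FinGSet.finite

section Diagrams

variable {G : Type u} [Group G] {X Y Z W A E Q : FinGSet G}

/-- The square with `p : W → X`, `q : W → Y`, `f : X → Z`, `g : Y → Z` is a pullback of `G`-sets. -/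
structure IsPullbackSquare (p : W →[G] X) (q : W →[G] Y) (f : X →[G] Z) (g : Y →[G] Z) : Prop where
  comm : ∀ t, f (p t) = g (q t)
  existsUnique : ∀ x y, f x = g y → ∃! t, p t = x ∧ q t = y

/-- `i : X → Z` and `j : Y → Z` exhibit `Z` as the disjoint union of `X` and `Y`. -/
def IsDisjointUnion (i : X →[G] Z) (j : Y →[G] Z) : Prop :=
  Function.Bijective (Sum.elim i j : X ⊕ Y → Z)

/-- The diagram `X ←p- A ←e- E -f'→ Q -q→ Y` is an exponential diagram for `f : X → Y` and
`p : A → X`. That is, `Q` is the dependent product `Π_f A`, whose points over `y : Y` are the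
sections `s : f⁻¹(y) → A` of `p`, the square on `E` is the pullback `E = X ×_Y Q`, and
`e : E → A` is the evaluation `(x, s) ↦ s x`. -/
structure IsExponentialDiagram (f : X →[G] Y) (p : A →[G] X)
    (e : E →[G] A) (f' : E →[G] Q) (q : Q →[G] Y) : Prop where
  isPullback : IsPullbackSquare (p.comp e) f' f q
  existsUnique : ∀ (y : Y) (s : {x : X // f x = y} → A), (∀ x, p (s x) = x) →
    ∃! z : Q, q z = y ∧
      ∀ (t : E) (x : {x : X // f x = y}), f' t = z → p (e t) = x → e t = s x

end Diagrams

/-- The transitive `G`-set `G/K`. -/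
def orbit {G : Type u} [Group G] [Finite G] (K : Subgroup G) : FinGSet G := ⟨G ⧸ K⟩

/-- The projection `G/K → G/L`, `gK ↦ gL`, for `K ≤ L`. -/
def orbitMap {G : Type u} [Group G] [Finite G] {K L : Subgroup G} (h : K ≤ L) :
    (orbit K : FinGSet G) →[G] (orbit L : FinGSet G) where
  toFun := Subgroup.quotientMapOfLE h
  map_smul' g x := by
    induction x using QuotientGroup.induction_on with
    | H a => rfl

section Restriction

variable {G : Type u} [Group G] (H : Subgroup G)

/-- A finite `G`-set regarded as an `H`-set. -/
def restrict (X : FinGSet G) : FinGSet H := ⟨X.carrier⟩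

variable {X Y : FinGSet G}

/-- A `G`-map regarded as an `H`-map. -/
def restrictMap (f : X →[G] Y) : (restrict H X) →[H] (restrict H Y) where
  toFun := f
  map_smul' h x := map_smul f (h : G) (show X from x)

end Restriction

section Induction

variable {G : Type u} [Group G] (H : Subgroup G)

/-- The relation `(g, x) ∼ (g h⁻¹, h x)`, for `h` in `H`, on `G × X`. -/
def indSetoid (X : FinGSet H) : Setoid (G × X) where
  r a b := ∃ h : H, b.1 = a.1 * (h : G)⁻¹ ∧ b.2 = h • a.2
  iseqv :=
    { refl := fun a => ⟨1, by simp, by simp⟩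
      symm := by
        rintro ⟨a, x⟩ ⟨b, y⟩ ⟨h, h1, h2⟩
        refine ⟨h⁻¹, ?_, ?_⟩
        · simp only at h1; simp [h1]
        · simp only at h2; simp [h2]
      trans := by
        rintro ⟨a, x⟩ ⟨b, y⟩ ⟨c, z⟩ ⟨h, h1, h2⟩ ⟨k, k1, k2⟩
        refine ⟨k * h, ?_, ?_⟩
        · simp only at h1 k1; simp [h1, k1, mul_assoc]
        · simp only at h2 k2; simp [h2, k2, mul_smul] }

instance indAction (X : FinGSet H) : MulAction G (Quotient (indSetoid H X)) where
  smul g := Quotient.map (fun a => (g * a.1, a.2)) (by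
    rintro ⟨a, x⟩ ⟨b, y⟩ ⟨h, h1, h2⟩
    exact ⟨h, by simp only at h1; simp [h1, mul_assoc], h2⟩)
  one_smul z := by
    induction z using Quotient.inductionOn with
    | h a => exact congrArg (Quotient.mk _) (by simp)
  mul_smul g g' z := by
    induction z using Quotient.inductionOn with
    | h a => exact congrArg (Quotient.mk _) (by simp [mul_assoc])

variable [Finite G]

/-- The induced `G`-set `G ×_H X`. -/
def induce (X : FinGSet H) : FinGSet G := ⟨Quotient (indSetoid H X)⟩

variable {H}

/-- The class `[g, x]` in `G ×_H X`. -/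
def indMk {X : FinGSet H} (g : G) (x : X) : induce H X := Quotient.mk (indSetoid H X) (g, x)

variable {X Y Z W A E Q : FinGSet H}

theorem indMk_surj (z : induce H X) : ∃ (g : G) (x : X), z = indMk g x := by
  induction z using Quotient.inductionOn with
  | h a => exact ⟨a.1, a.2, rfl⟩

theorem indMk_eq {g g' : G} {x x' : X} :
    (indMk g x : induce H X) = indMk g' x' ↔ ∃ h : H, g' = g * (h : G)⁻¹ ∧ x' = h • x :=
  Quotient.eq (r := indSetoid H X)

theorem smul_indMk (g g' : G) (x : X) : g • (indMk g' x : induce H X) = indMk (g * g') x := rfl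

theorem indMk_inj {g : G} {x x' : X} (h : (indMk g x : induce H X) = indMk g x') : x = x' := by
  obtain ⟨h, h1, h2⟩ := indMk_eq.1 h
  have : h = 1 := by simpa using h1
  simpa [this] using h2.symm

variable (H) in
/-- The induced map `G ×_H X → G ×_H Y`, `[g, x] ↦ [g, f x]`. -/
def induceMap (f : X →[H] Y) : (induce H X) →[G] (induce H Y) where
  toFun := Quotient.map (fun a => (a.1, f a.2)) (by
    rintro ⟨a, x⟩ ⟨b, y⟩ ⟨h, h1, h2⟩
    exact ⟨h, h1, by simp only at h2; simp [h2]⟩)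
  map_smul' g z := by
    induction z using Quotient.inductionOn with
    | h a => rfl

@[simp] theorem induceMap_mk (f : X →[H] Y) (g : G) (x : X) :
    induceMap H f (indMk g x) = indMk g (f x) := rfl

theorem induceMap_id : induceMap H (MulActionHom.id H : X →[H] X) = MulActionHom.id G := by
  ext z
  obtain ⟨g, x, rfl⟩ := indMk_surj z
  rfl

theorem induceMap_comp (f : X →[H] Y) (k : Y →[H] Z) :
    induceMap H (k.comp f) = (induceMap H k).comp (induceMap H f) := by
  ext z
  obtain ⟨g, x, rfl⟩ := indMk_surj z
  rfl

theorem induceMap_lift (f : X →[H] Y) {z : induce H X} {g : G} {y : Y}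
    (h : induceMap H f z = indMk g y) : ∃ x, z = indMk g x ∧ f x = y := by
  obtain ⟨a, x, rfl⟩ := indMk_surj z
  obtain ⟨k, k1, k2⟩ := indMk_eq.1 (by simpa using h)
  exact ⟨k • x, indMk_eq.2 ⟨k, k1, rfl⟩, by simp [k2]⟩

theorem IsPullbackSquare.induce {p : W →[H] X} {q : W →[H] Y} {f : X →[H] Z} {g : Y →[H] Z}
    (h : IsPullbackSquare p q f g) : IsPullbackSquare (induceMap H p) (induceMap H q)
      (induceMap H f) (induceMap H g) where
  comm t := by
    obtain ⟨a, t, rfl⟩ := indMk_surj t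
    simp [h.comm]
  existsUnique x y hxy := by
    obtain ⟨a, x, rfl⟩ := indMk_surj x
    obtain ⟨y, rfl, hy⟩ := induceMap_lift g (hxy.symm.trans (induceMap_mk f a x))
    obtain ⟨t, ⟨h1, h2⟩, h3⟩ := h.existsUnique x y hy.symm
    refine ⟨indMk a t, ⟨by simp [h1], by simp [h2]⟩, ?_⟩
    rintro t' ⟨h4, h5⟩
    obtain ⟨t', rfl, h6⟩ := induceMap_lift p h4
    rw [h3 t' ⟨h6, indMk_inj h5⟩]

theorem IsDisjointUnion.induce {i : X →[H] Z} {j : Y →[H] Z} (h : IsDisjointUnion i j) :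
    IsDisjointUnion (induceMap H i) (induceMap H j) := by
  have key : ∀ a b, Sum.elim i j a = Sum.elim i j b → a = b := fun a b hab => h.1 hab
  constructor
  · rintro (a | a) (b | b) hab
    · obtain ⟨g, x, rfl⟩ := indMk_surj b
      obtain ⟨y, rfl, hy⟩ := induceMap_lift i hab
      have := key (.inl y) (.inl x) hy
      simp_all
    · obtain ⟨g, x, rfl⟩ := indMk_surj b
      obtain ⟨y, rfl, hy⟩ := induceMap_lift i hab
      have := key (.inl y) (.inr x) hy
      simp_all
    · obtain ⟨g, x, rfl⟩ := indMk_surj b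
      obtain ⟨y, rfl, hy⟩ := induceMap_lift j hab
      have := key (.inr y) (.inl x) hy
      simp_all
    · obtain ⟨g, x, rfl⟩ := indMk_surj b
      obtain ⟨y, rfl, hy⟩ := induceMap_lift j hab
      have := key (.inr y) (.inr x) hy
      simp_all
  · intro z
    obtain ⟨g, z, rfl⟩ := indMk_surj z
    obtain ⟨a | a, rfl⟩ := h.2 z
    · exact ⟨.inl (indMk g a), rfl⟩
    · exact ⟨.inr (indMk g a), rfl⟩

theorem IsExponentialDiagram.induce {f : X →[H] Y} {p : A →[H] X}
    {e : E →[H] A} {f' : E →[H] Q} {q : Q →[H] Y} (h : IsExponentialDiagram f p e f' q) :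
    IsExponentialDiagram (induceMap H f) (induceMap H p) (induceMap H e) (induceMap H f')
      (induceMap H q) where
  isPullback := by
    rw [← induceMap_comp]
    exact h.isPullback.induce
  existsUnique y s hs := by
    obtain ⟨a, y, rfl⟩ := indMk_surj y
    have h0 : ∀ x : {x : X // f x = y}, ∃ b : A,
        s ⟨indMk a x.1, by simp [x.2]⟩ = indMk a b ∧ p b = x.1 := fun x =>
      induceMap_lift p (hs ⟨indMk a x.1, by simp [x.2]⟩)
    choose s₀ hs₀ hp₀ using h0
    obtain ⟨z, ⟨hz, hz'⟩, huniq⟩ := h.existsUnique y s₀ hp₀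
    refine ⟨indMk a z, ⟨by simp [hz], ?_⟩, ?_⟩
    · rintro t ⟨x, hx⟩ ht hpt
      obtain ⟨t, rfl, ht'⟩ := induceMap_lift f' ht
      simp only [induceMap_mk] at hpt
      subst hpt
      have hx' : f (p (e t)) = y := indMk_inj hx
      exact (congrArg (indMk a) (hz' t ⟨p (e t), hx'⟩ ht' rfl)).trans (hs₀ ⟨p (e t), hx'⟩).symm
    · rintro z' ⟨h1, h2⟩
      obtain ⟨z', rfl, hz₁⟩ := induceMap_lift q h1
      rw [huniq z' ⟨hz₁, ?_⟩]
      rintro t x ht hpt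
      have := h2 (indMk a t) ⟨indMk a x.1, by simp [x.2]⟩ (by simp [ht]) (by simp [hpt])
      rw [hs₀ x] at this
      exact indMk_inj this

variable (H) in
/-- The action map `G ×_H X → X`, `[g, x] ↦ g x`, for a `G`-set `X`. -/
def actMap (X : FinGSet G) : (induce H (restrict H X)) →[G] X where
  toFun := Quotient.lift (fun a : G × restrict H X => a.1 • (show X from a.2)) (by
    rintro ⟨a, x⟩ ⟨b, y⟩ ⟨h, h1, h2⟩
    simp only at h1 h2
    subst h1 h2
    change a • (show X from x) = (a * (h : G)⁻¹) • ((h : G) • (show X from x))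
    rw [smul_smul, inv_mul_cancel_right])
  map_smul' g z := by
    induction z using Quotient.inductionOn with
    | h a => exact mul_smul g a.1 (show X from a.2)

@[simp] theorem actMap_mk (X : FinGSet G) (g : G) (x : X) :
    actMap H X (indMk (X := restrict H X) g x) = g • x := rfl

theorem actMap_isPullback {X Y : FinGSet G} (f : X →[G] Y) :
    IsPullbackSquare (actMap H X) (induceMap H (restrictMap H f)) f (actMap H Y) where
  comm t := by
    obtain ⟨a, (t : X), rfl⟩ := indMk_surj t
    exact map_smul f a t
  existsUnique x y hxy := by
    obtain ⟨a, (y : Y), rfl⟩ := indMk_surj y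
    have hy : f x = a • y := hxy
    refine ⟨indMk (X := restrict H X) a (a⁻¹ • x : X), ⟨?_, ?_⟩, ?_⟩
    · simp
    · change indMk (X := restrict H Y) a (f (a⁻¹ • x)) = _
      rw [map_smul, hy, inv_smul_smul]
    · rintro t ⟨h1, h2⟩
      obtain ⟨t, rfl, -⟩ := induceMap_lift (restrictMap H f) h2
      have : a • (show X from t) = x := h1
      rw [← this, inv_smul_smul]

end Induction

end FinGSet

section Tambara

open FinGSet

/-- A `G`-Tambara functor: commutative rings `R(X)` for all finite `G`-sets `X`, with restrictions
`f^*`, transfers `f_+` and norms `f_•` along all maps `f` of finite `G`-sets. All three are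
functorial, `R` takes disjoint unions to products, transfers and norms satisfy the base change
formula for pullback squares, and `f_• p_+ = q_+ f'_• e^*` for every exponential diagram. -/
structure TambaraFunctor (G : Type u) [Group G] where
  obj : FinGSet G → Type v
  [ring : ∀ X, CommRing (obj X)]
  res : ∀ {X Y : FinGSet G}, (X →[G] Y) → (obj Y →+* obj X)
  tr : ∀ {X Y : FinGSet G}, (X →[G] Y) → (obj X →+ obj Y)
  nm : ∀ {X Y : FinGSet G}, (X →[G] Y) → (obj X →* obj Y)
  res_id : ∀ {X : FinGSet G} (a : obj X), res (MulActionHom.id G) a = a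
  res_comp : ∀ {X Y Z : FinGSet G} (f : X →[G] Y) (g : Y →[G] Z) (a : obj Z),
    res (g.comp f) a = res f (res g a)
  tr_id : ∀ {X : FinGSet G} (a : obj X), tr (MulActionHom.id G) a = a
  tr_comp : ∀ {X Y Z : FinGSet G} (f : X →[G] Y) (g : Y →[G] Z) (a : obj X),
    tr (g.comp f) a = tr g (tr f a)
  nm_id : ∀ {X : FinGSet G} (a : obj X), nm (MulActionHom.id G) a = a
  nm_comp : ∀ {X Y Z : FinGSet G} (f : X →[G] Y) (g : Y →[G] Z) (a : obj X),
    nm (g.comp f) a = nm g (nm f a)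
  subsingleton_of_isEmpty : ∀ (X : FinGSet G), IsEmpty X → Subsingleton (obj X)
  bijective_of_isDisjointUnion : ∀ {X Y Z : FinGSet G} (i : X →[G] Z) (j : Y →[G] Z),
    IsDisjointUnion i j → Function.Bijective fun a : obj Z => (res i a, res j a)
  res_tr : ∀ {W X Y Z : FinGSet G} (p : W →[G] X) (q : W →[G] Y) (f : X →[G] Z) (g : Y →[G] Z),
    IsPullbackSquare p q f g → ∀ a : obj X, res g (tr f a) = tr q (res p a)
  res_nm : ∀ {W X Y Z : FinGSet G} (p : W →[G] X) (q : W →[G] Y) (f : X →[G] Z) (g : Y →[G] Z),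
    IsPullbackSquare p q f g → ∀ a : obj X, res g (nm f a) = nm q (res p a)
  nm_tr : ∀ {X Y A E Q : FinGSet G} (f : X →[G] Y) (p : A →[G] X) (e : E →[G] A)
    (f' : E →[G] Q) (q : Q →[G] Y), IsExponentialDiagram f p e f' q →
    ∀ a : obj A, nm f (tr p a) = tr q (nm f' (res e a))

namespace TambaraFunctor

attribute [instance] TambaraFunctor.ring

/-- A morphism of Tambara functors. -/
structure Hom {G : Type u} [Group G] (R : TambaraFunctor.{u, v} G)
    (S : TambaraFunctor.{u, w} G) where
  app : ∀ X : FinGSet G, R.obj X →+* S.obj X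
  app_res : ∀ {X Y : FinGSet G} (f : X →[G] Y) (a : R.obj Y),
    app X (R.res f a) = S.res f (app Y a)
  app_tr : ∀ {X Y : FinGSet G} (f : X →[G] Y) (a : R.obj X),
    app Y (R.tr f a) = S.tr f (app X a)
  app_nm : ∀ {X Y : FinGSet G} (f : X →[G] Y) (a : R.obj X),
    app Y (R.nm f a) = S.nm f (app X a)

/-- A Tambara ideal. For `f` surjective `f_•(0) = 0`, so that the condition on norms reads
`f_•(I(X)) ⊆ I(Y)`. -/
@[ext] structure TambaraIdeal {G : Type u} [Group G] (R : TambaraFunctor.{u, v} G) where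
  carrier : ∀ X : FinGSet G, Ideal (R.obj X)
  res_mem : ∀ {X Y : FinGSet G} (f : X →[G] Y) {a : R.obj Y},
    a ∈ carrier Y → R.res f a ∈ carrier X
  tr_mem : ∀ {X Y : FinGSet G} (f : X →[G] Y) {a : R.obj X},
    a ∈ carrier X → R.tr f a ∈ carrier Y
  nm_mem : ∀ {X Y : FinGSet G} (f : X →[G] Y) {a : R.obj X},
    a ∈ carrier X → R.nm f a - R.nm f 0 ∈ carrier Y

namespace TambaraIdeal

variable {G : Type u} [Group G] {R : TambaraFunctor.{u, v} G}

/-- Levelwise inclusion. -/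
instance : PartialOrder (TambaraIdeal R) :=
  PartialOrder.lift TambaraIdeal.carrier fun _ _ h => TambaraIdeal.ext h

/-- The zero ideal. -/
instance : Bot (TambaraIdeal R) where
  bot :=
    { carrier := fun _ => ⊥
      res_mem := fun f a ha => by
        rw [Ideal.mem_bot] at ha ⊢
        rw [ha, map_zero]
      tr_mem := fun f a ha => by
        rw [Ideal.mem_bot] at ha ⊢
        rw [ha, map_zero]
      nm_mem := fun f a ha => by
        rw [Ideal.mem_bot] at ha ⊢
        rw [ha, sub_self] }

/-- The ideal `R` itself. -/
instance : Top (TambaraIdeal R) where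
  top :=
    { carrier := fun _ => ⊤
      res_mem := fun _ _ _ => Submodule.mem_top
      tr_mem := fun _ _ _ => Submodule.mem_top
      nm_mem := fun _ _ _ => Submodule.mem_top }

/-- The Tambara ideal generated by a family of sets: the intersection of all Tambara ideals that
contain it. -/
def span (S : ∀ X : FinGSet G, Set (R.obj X)) : TambaraIdeal R where
  carrier X := ⨅ I : {I : TambaraIdeal R // ∀ Y, S Y ⊆ I.carrier Y}, I.1.carrier X
  res_mem f a ha := by
    rw [Ideal.mem_iInf] at ha ⊢
    exact fun I => I.1.res_mem f (ha I)
  tr_mem f a ha := by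
    rw [Ideal.mem_iInf] at ha ⊢
    exact fun I => I.1.tr_mem f (ha I)
  nm_mem f a ha := by
    rw [Ideal.mem_iInf] at ha ⊢
    exact fun I => I.1.nm_mem f (ha I)

/-- The product of two Tambara ideals: the Tambara ideal generated by the levelwise products. -/
instance : Mul (TambaraIdeal R) where
  mul I J := span fun X => {c | ∃ a ∈ I.carrier X, ∃ b ∈ J.carrier X, c = a * b}

/-- Prime Tambara ideals. -/
def IsPrime (P : TambaraIdeal R) : Prop :=
  P ≠ ⊤ ∧ ∀ I J : TambaraIdeal R, I * J ≤ P → I ≤ P ∨ J ≤ P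

/-- The contraction of a Tambara ideal along a morphism of Tambara functors. -/
def comap {S : TambaraFunctor.{u, w} G} (φ : Hom R S) (I : TambaraIdeal S) : TambaraIdeal R where
  carrier X := (I.carrier X).comap (φ.app X)
  res_mem f a ha := by
    rw [Ideal.mem_comap] at ha ⊢
    rw [φ.app_res]
    exact I.res_mem f ha
  tr_mem f a ha := by
    rw [Ideal.mem_comap] at ha ⊢
    rw [φ.app_tr]
    exact I.tr_mem f ha
  nm_mem f a ha := by
    rw [Ideal.mem_comap] at ha ⊢
    rw [map_sub, φ.app_nm, φ.app_nm, map_zero]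
    exact I.nm_mem f ha

end TambaraIdeal

section ChangeOfGroup

variable {G : Type u} [Group G]

/-- The restriction `Res_H^G R`, given by `X ↦ R(G ×_H X)`. In particular its value at `H/K` is
`R(G/K)`. -/
def resFunctor [Finite G] (R : TambaraFunctor.{u, v} G) (H : Subgroup G) :
    TambaraFunctor.{u, v} H where
  obj X := R.obj (induce H X)
  ring X := R.ring (induce H X)
  res f := R.res (induceMap H f)
  tr f := R.tr (induceMap H f)
  nm f := R.nm (induceMap H f)
  res_id a := by rw [induceMap_id, R.res_id]
  res_comp f g a := by rw [induceMap_comp, R.res_comp]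
  tr_id a := by rw [induceMap_id, R.tr_id]
  tr_comp f g a := by rw [induceMap_comp, R.tr_comp]
  nm_id a := by rw [induceMap_id, R.nm_id]
  nm_comp f g a := by rw [induceMap_comp, R.nm_comp]
  subsingleton_of_isEmpty X hX := R.subsingleton_of_isEmpty _
    ⟨fun z => by obtain ⟨_, x, -⟩ := indMk_surj z; exact hX.elim x⟩
  bijective_of_isDisjointUnion i j h := R.bijective_of_isDisjointUnion _ _ h.induce
  res_tr p q f g h := R.res_tr _ _ _ _ h.induce
  res_nm p q f g h := R.res_nm _ _ _ _ h.induce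
  nm_tr f p e f' q h := R.nm_tr _ _ _ _ _ h.induce

/-- The coinduction `CoInd_H^G S`, given by `X ↦ S(X)` with `X` regarded as an `H`-set. -/
def coindFunctor (H : Subgroup G) (S : TambaraFunctor.{u, v} H) : TambaraFunctor.{u, v} G where
  obj X := S.obj (restrict H X)
  ring X := S.ring (restrict H X)
  res f := S.res (restrictMap H f)
  tr f := S.tr (restrictMap H f)
  nm f := S.nm (restrictMap H f)
  res_id a := S.res_id a
  res_comp f g a := S.res_comp (restrictMap H f) (restrictMap H g) a
  tr_id a := S.tr_id a
  tr_comp f g a := S.tr_comp (restrictMap H f) (restrictMap H g) a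
  nm_id a := S.nm_id a
  nm_comp f g a := S.nm_comp (restrictMap H f) (restrictMap H g) a
  subsingleton_of_isEmpty X hX := S.subsingleton_of_isEmpty (restrict H X) hX
  bijective_of_isDisjointUnion i j h := S.bijective_of_isDisjointUnion _ _ h
  res_tr p q f g h := S.res_tr _ _ _ _ ⟨h.1, h.2⟩
  res_nm p q f g h := S.res_nm _ _ _ _ ⟨h.1, h.2⟩
  nm_tr f p e f' q h := S.nm_tr _ _ _ _ _ ⟨⟨h.1.1, h.1.2⟩, h.2⟩

/-- The coinduction of a Tambara ideal. -/
def TambaraIdeal.coind {H : Subgroup G} {S : TambaraFunctor.{u, v} H} (I : TambaraIdeal S) :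
    TambaraIdeal (coindFunctor H S) where
  carrier X := I.carrier (restrict H X)
  res_mem f _ ha := I.res_mem (restrictMap H f) ha
  tr_mem f _ ha := I.tr_mem (restrictMap H f) ha
  nm_mem f _ ha := I.nm_mem (restrictMap H f) ha

/-- The unit `R → CoInd_H^G Res_H^G R` of the adjunction between restriction and coinduction. At
level `X` it is the restriction of `R` along the action map `G ×_H X → X`. -/
def coindUnit [Finite G] (R : TambaraFunctor.{u, v} G) (H : Subgroup G) :
    Hom R (coindFunctor H (R.resFunctor H)) where
  app X := R.res (actMap H X)
  app_res {X Y} f a := by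
    change R.res (actMap H X) (R.res f a) =
      R.res (induceMap H (restrictMap H f)) (R.res (actMap H Y) a)
    rw [← R.res_comp, ← R.res_comp]
    congr 2
    ext t
    exact (actMap_isPullback f).comm t
  app_tr f a := R.res_tr _ _ _ _ (actMap_isPullback f) a
  app_nm f a := R.res_nm _ _ _ _ (actMap_isPullback f) a

end ChangeOfGroup

section Spectrum

variable {G : Type u} [Group G]

/-- The Nakaoka spectrum of `R`: the set of prime Tambara ideals. -/
def Spec (R : TambaraFunctor.{u, v} G) : Type (max (u + 1) v) :=
  {P : TambaraIdeal R // P.IsPrime}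

/-- The set `V(I)` of all prime ideals that contain `I`. -/
def zeroLocus {R : TambaraFunctor.{u, v} G} (I : TambaraIdeal R) : Set R.Spec := {P | I ≤ P.1}

/-- The topology whose closed sets are generated by the sets `V(I)`. -/
instance (R : TambaraFunctor.{u, v} G) : TopologicalSpace R.Spec :=
  TopologicalSpace.generateFrom {U | ∃ I : TambaraIdeal R, U = (zeroLocus I)ᶜ}

/-- The zero ideal is prime. -/
def IsDomainLike (R : TambaraFunctor.{u, v} G) : Prop := (⊥ : TambaraIdeal R).IsPrime

/-- The `H`-th stratum of `Spec R`: the image of `Spec (Res_H^G R) → Spec R`, the map that sends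
`Q` to the contraction, along the unit `R → CoInd_H^G Res_H^G R`, of the coinduction of `Q`. -/
def stratum [Finite G] (R : TambaraFunctor.{u, v} G) (H : Subgroup G) : Set R.Spec :=
  {P | ∃ Q : (R.resFunctor H).Spec, P.1 = Q.1.coind.comap (R.coindUnit H)}

end Spectrum

end TambaraFunctor

end Tambara

/-! If `R` is domain-like, the zero ideal is a generic point of the spectrum: it lies in every
nonempty open set (`IsDomainLike.bot_mem_of_isOpen`). The stratum is nonempty, so if it were open,
zero would be the contraction of some prime `Q` of the restriction to `H`. But the action map `G ×_H
G/G → G/G` factors through `G/H`, so every such contraction contains the kernel of `R(G/G) → R(G/H)`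
(`res_actMap_eq_zero`). This kernel would then vanish, against the hypothesis.

Most of the work is in nonemptiness, i.e. in producing a prime of the restriction and showing that
its contraction is prime. At the bottom level, the value on the free orbit, take a maximal ideal
`I`; it exists because a domain-like `R` is nonzero on every nonempty `G`-set. The elements all of
whose restrictions to points of the free orbit lie in `I` form a prime Tambara ideal
(`pointIdeal_isPrime`). Closure under transfers and norms holds because, over a free orbit, these
are sums and products of conjugates (`tr_nm_mem_of_free`). -/

namespace FinGSet

/-! ### Free orbits, complements and pullbacks of finite `G`-sets. -/

variable {G : Type u} [Group G]

/-- The empty `G`-set. -/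
def empty (G : Type u) [Group G] : FinGSet G where
  carrier := PEmpty
  action := { smul := fun _ x => x, one_smul := fun x => x.elim, mul_smul := fun _ _ x => x.elim }

instance : IsEmpty (empty G) := inferInstanceAs (IsEmpty PEmpty)

/-- The equivariant map out of an empty `G`-set. -/
def ofIsEmpty {X : FinGSet G} (hX : IsEmpty X) (Y : FinGSet G) : X →[G] Y where
  toFun x := hX.elim x
  map_smul' _ x := hX.elim x

/-- The group `G` as a free `G`-set. -/
def free (G : Type u) [Group G] [Finite G] : FinGSet G := ⟨G⟩

/-- The orbit map `G → X`, `g ↦ g x`. -/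
def orbitHom [Finite G] {X : FinGSet G} (x : X) : free G →[G] X where
  toFun g := (show G from g) • x
  map_smul' g h := mul_smul g (show G from h) x

/-- The complement of the range of an equivariant map. -/
def rangeCompl {X Y : FinGSet G} (i : X →[G] Y) : FinGSet G where
  carrier := {y : Y // y ∉ Set.range i}
  action :=
    { smul := fun g y => ⟨g • y.1, by
        rintro ⟨x, hx⟩
        exact y.2 ⟨g⁻¹ • x, by rw [map_smul, hx, inv_smul_smul]⟩⟩
      one_smul := fun y => Subtype.ext (one_smul G y.1)
      mul_smul := fun g h y => Subtype.ext (mul_smul g h y.1) }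

/-- The inclusion of the complement of the range of an equivariant map. -/
def rangeComplHom {X Y : FinGSet G} (i : X →[G] Y) : rangeCompl i →[G] Y where
  toFun y := y.1
  map_smul' _ _ := rfl

theorem isDisjointUnion_rangeCompl {X Y : FinGSet G} (i : X →[G] Y)
    (hi : Function.Injective i) : IsDisjointUnion i (rangeComplHom i) := by
  constructor
  · rintro (a | a) (b | b) hab
    · exact congrArg Sum.inl (hi hab)
    · exact (b.2 ⟨a, hab⟩).elim
    · exact (a.2 ⟨b, hab.symm⟩).elim
    · exact congrArg Sum.inr (Subtype.ext hab)
  · intro y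
    by_cases hy : y ∈ Set.range i
    · obtain ⟨x, rfl⟩ := hy
      exact ⟨.inl x, rfl⟩
    · exact ⟨.inr ⟨y, hy⟩, rfl⟩

/-- The pullback of two equivariant maps. -/
def pullback {X Y Z : FinGSet G} (f : X →[G] Z) (g : Y →[G] Z) : FinGSet G where
  carrier := {t : X × Y // f t.1 = g t.2}
  action :=
    { smul := fun a t => ⟨(a • t.1.1, a • t.1.2), by rw [map_smul, map_smul, t.2]⟩
      one_smul := fun t => Subtype.ext (Prod.ext (one_smul G t.1.1) (one_smul G t.1.2))
      mul_smul := fun a b t =>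
        Subtype.ext (Prod.ext (mul_smul a b t.1.1) (mul_smul a b t.1.2)) }

/-- The first projection of a pullback. -/
def pullbackFst {X Y Z : FinGSet G} (f : X →[G] Z) (g : Y →[G] Z) : pullback f g →[G] X where
  toFun t := t.1.1
  map_smul' _ _ := rfl

/-- The second projection of a pullback. -/
def pullbackSnd {X Y Z : FinGSet G} (f : X →[G] Z) (g : Y →[G] Z) : pullback f g →[G] Y where
  toFun t := t.1.2
  map_smul' _ _ := rfl

theorem pullback_isPullbackSquare {X Y Z : FinGSet G} (f : X →[G] Z) (g : Y →[G] Z) :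
    IsPullbackSquare (pullbackFst f g) (pullbackSnd f g) f g where
  comm t := t.2
  existsUnique x y h :=
    ⟨⟨(x, y), h⟩, ⟨rfl, rfl⟩, fun _ h' => Subtype.ext (Prod.ext h'.1 h'.2)⟩

theorem isPullbackSquare_of_injective {X Y : FinGSet G} {i : X →[G] Y}
    (hi : Function.Injective i) :
    IsPullbackSquare (MulActionHom.id G) (MulActionHom.id G) i i where
  comm _ := rfl
  existsUnique x y h := ⟨x, ⟨rfl, hi h⟩, fun _ h' => h'.1⟩

theorem IsDisjointUnion.isPullbackSquare {X Y Z : FinGSet G} {i : X →[G] Z} {j : Y →[G] Z}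
    (h : IsDisjointUnion i j) :
    IsPullbackSquare (ofIsEmpty (X := empty G) inferInstance X) (ofIsEmpty inferInstance Y)
      i j where
  comm t := isEmptyElim t
  existsUnique x y hxy := by
    have := h.1 (a₁ := .inl x) (a₂ := .inr y) hxy
    simp at this

theorem IsDisjointUnion.symm {X Y Z : FinGSet G} {i : X →[G] Z} {j : Y →[G] Z}
    (h : IsDisjointUnion i j) : IsDisjointUnion j i := by
  have : (Sum.elim j i : Y ⊕ X → Z) = Sum.elim i j ∘ Sum.swap := by
    ext (a | a) <;> rfl
  unfold IsDisjointUnion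
  rw [this]
  exact h.comp (Equiv.sumComm Y X).bijective

theorem IsDisjointUnion.injective_left {X Y Z : FinGSet G} {i : X →[G] Z} {j : Y →[G] Z}
    (h : IsDisjointUnion i j) : Function.Injective i :=
  fun a b hab => Sum.inl_injective (h.1 (a₁ := .inl a) (a₂ := .inl b) hab)

end FinGSet

namespace TambaraFunctor

open FinGSet

/-! ### Transfers and norms along disjoint unions, norms of zero. -/

section Basic

variable {G : Type u} [Group G] (R : TambaraFunctor.{u, v} G)

theorem res_tr_of_injective {X Y : FinGSet G} {i : X →[G] Y} (hi : Function.Injective i)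
    (a : R.obj X) : R.res i (R.tr i a) = a := by
  rw [R.res_tr _ _ _ _ (isPullbackSquare_of_injective hi), R.res_id, R.tr_id]

theorem res_nm_of_injective {X Y : FinGSet G} {i : X →[G] Y} (hi : Function.Injective i)
    (a : R.obj X) : R.res i (R.nm i a) = a := by
  rw [R.res_nm _ _ _ _ (isPullbackSquare_of_injective hi), R.res_id, R.nm_id]

theorem res_tr_of_isDisjointUnion {X Y Z : FinGSet G} {i : X →[G] Z} {j : Y →[G] Z}
    (h : IsDisjointUnion i j) (a : R.obj X) : R.res j (R.tr i a) = 0 := by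
  have := R.subsingleton_of_isEmpty (empty G) inferInstance
  rw [R.res_tr _ _ _ _ h.isPullbackSquare, Subsingleton.elim (R.res _ a) 0, map_zero]

theorem res_nm_of_isDisjointUnion {X Y Z : FinGSet G} {i : X →[G] Z} {j : Y →[G] Z}
    (h : IsDisjointUnion i j) (a : R.obj X) : R.res j (R.nm i a) = 1 := by
  have := R.subsingleton_of_isEmpty (empty G) inferInstance
  rw [R.res_nm _ _ _ _ h.isPullbackSquare, Subsingleton.elim (R.res _ a) 1, map_one]

theorem eq_tr_add_tr {X Y Z : FinGSet G} {i : X →[G] Z} {j : Y →[G] Z}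
    (h : IsDisjointUnion i j) (c : R.obj Z) :
    c = R.tr i (R.res i c) + R.tr j (R.res j c) := by
  apply (R.bijective_of_isDisjointUnion i j h).1
  simp only [map_add, R.res_tr_of_injective h.injective_left,
    R.res_tr_of_injective h.symm.injective_left, R.res_tr_of_isDisjointUnion h,
    R.res_tr_of_isDisjointUnion h.symm, add_zero, zero_add]

/-- Multiplicative analogue of `eq_tr_add_tr`: off its image, the norm along an inclusion is 1,
where the transfer is 0. -/
theorem eq_nm_mul_nm {X Y Z : FinGSet G} {i : X →[G] Z} {j : Y →[G] Z}
    (h : IsDisjointUnion i j) (c : R.obj Z) :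
    c = R.nm i (R.res i c) * R.nm j (R.res j c) := by
  apply (R.bijective_of_isDisjointUnion i j h).1
  simp only [map_mul, R.res_nm_of_injective h.injective_left,
    R.res_nm_of_injective h.symm.injective_left, R.res_nm_of_isDisjointUnion h,
    R.res_nm_of_isDisjointUnion h.symm, mul_one, one_mul]

/-- Norms along surjections preserve zero. -/
theorem nm_zero_of_surjective {X Y : FinGSet G} {f : X →[G] Y} (hf : Function.Surjective f) :
    R.nm f 0 = 0 := by
  have := R.subsingleton_of_isEmpty (empty G) inferInstance
  -- Nonempty fibres have no sections into the empty set, so the dependent product is empty too. The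
  -- norm of zero therefore factors through the zero ring `R(∅)`.
  have h : IsExponentialDiagram f (ofIsEmpty (X := empty G) inferInstance X)
      (MulActionHom.id G) (MulActionHom.id G) (ofIsEmpty inferInstance Y) :=
    { isPullback :=
        { comm := fun t => isEmptyElim t
          existsUnique := fun _ y => isEmptyElim y }
      existsUnique := fun y s _ => by
        obtain ⟨x, hx⟩ := hf y
        exact isEmptyElim (s ⟨x, hx⟩) }
  have key := R.nm_tr _ _ _ _ _ h 0
  rw [map_zero] at key
  rw [key, Subsingleton.elim (R.nm _ _) 0, map_zero]

end Basic

/-! ### Products of Tambara ideals. -/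

section IdealProduct

variable {G : Type u} [Group G] {R : TambaraFunctor.{u, v} G}

theorem TambaraIdeal.mul_mem_mul {I J : TambaraIdeal R} {X : FinGSet G} {a b : R.obj X} (ha : a ∈ I.carrier X)
    (hb : b ∈ J.carrier X) : a * b ∈ (I * J).carrier X :=
  Ideal.mem_iInf.2 fun K => K.2 X ⟨a, ha, b, hb, rfl⟩

theorem TambaraIdeal.mul_le {I J K : TambaraIdeal R}
    (h : ∀ X, ∀ a ∈ I.carrier X, ∀ b ∈ J.carrier X, a * b ∈ K.carrier X) : I * J ≤ K := by
  intro X c hc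
  refine Ideal.mem_iInf.1 hc ⟨K, fun Y => ?_⟩
  rintro _ ⟨a, ha, b, hb, rfl⟩
  exact h Y a ha b hb

end IdealProduct

/-! ### Prime Tambara ideals from primes of the bottom level. -/

section PointIdeal

variable {G : Type u} [Group G] [Finite G] {R : TambaraFunctor.{u, v} G}

/-- Equivariant self-maps of the free orbit are invertible. -/
theorem exists_inverse_of_free (f : free G →[G] free G) :
    ∃ k : free G →[G] free G, IsPullbackSquare k (MulActionHom.id G) f (MulActionHom.id G) := by
  have hf : ∀ g : G, f g = (g * (show G from f (1 : G)) : G) := fun g => by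
    have h := map_smul f g (show free G from (1 : G))
    have h1 : g • (show free G from (1 : G)) = (show free G from g) := mul_one g
    rw [h1] at h
    exact h
  -- `f` is right multiplication by `f 1`, so its inverse is right multiplication by `(f 1)⁻¹`.
  refine ⟨orbitHom (X := free G) (show G from (show G from f (1 : G))⁻¹), fun t => ?_,
    fun x y hxy => ?_⟩
  · exact (hf _).trans (inv_mul_cancel_right (show G from t) _)
  · refine ⟨y, ⟨?_, rfl⟩, fun t h => h.2⟩
    have h1 : ((show G from x) * (show G from f (1 : G)) : G) = y := (hf x).symm.trans hxy
    change ((show G from y) * (show G from f (1 : G))⁻¹ : G) = x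
    rw [← h1]
    exact mul_inv_cancel_right (show G from x) _

/-- Over the free `G`-set `G`, transfers and differences of norms of elements whose restrictions
to all points lie in an ideal lie in this ideal. -/
theorem tr_nm_mem_of_free (I : Ideal (R.obj (free G))) (n : ℕ) :
    ∀ (W : FinGSet G) (q : W →[G] free G) (c : R.obj W), Nat.card W = n →
      (∀ x : free G →[G] W, R.res x c ∈ I) →
      R.tr q c ∈ I ∧ R.nm q c - R.nm q 0 ∈ I := by
  induction n using Nat.strong_induction_on with
  | _ n ih =>
  intro W q c hn hc
  rcases isEmpty_or_nonempty W with hW | ⟨⟨w⟩⟩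
  · have := R.subsingleton_of_isEmpty W hW
    -- The norm from the empty set is 1, even at 0; this is why the claim concerns a difference of
    -- norms.
    rw [Subsingleton.elim c 0, map_zero, sub_self]
    exact ⟨I.zero_mem, I.zero_mem⟩
  set i := orbitHom w
  -- Stabilizers in `W` are trivial because `W` maps to a free orbit.
  have hi : Function.Injective i := by
    intro a b hab
    have h1 : (show G from a) • q w = (show G from b) • q w := by
      rw [← map_smul, ← map_smul]
      exact congrArg q hab
    exact mul_right_cancel (b := (show G from q w)) h1
  have hd := isDisjointUnion_rangeCompl i hi
  set j := rangeComplHom i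
  have hcard : Nat.card (rangeCompl i) < n := by
    rw [← hn]
    exact Finite.card_subtype_lt (p := fun y => y ∉ Set.range i) (x := w)
      (not_not.2 ⟨show free G from (1 : G), one_smul G w⟩)
  obtain ⟨hj1, hj2⟩ := ih _ hcard (rangeCompl i) (q.comp j) (R.res j c) rfl fun x => by
    rw [← R.res_comp]
    exact hc _
  obtain ⟨k, hk⟩ := exists_inverse_of_free (q.comp i)
  -- Base change along the square of an isomorphism and its inverse `k` identifies transfer and norm
  -- with restriction along `k`.
  have htr : ∀ a, R.tr (q.comp i) a = R.res k a := fun a => by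
    rw [← R.tr_id (R.res k a), ← R.res_tr _ _ _ _ hk, R.res_id]
  have hnm : ∀ a, R.nm (q.comp i) a = R.res k a := fun a => by
    rw [← R.nm_id (R.res k a), ← R.res_nm _ _ _ _ hk, R.res_id]
  have hki : R.res k (R.res i c) ∈ I := by
    rw [← R.res_comp]
    exact hc _
  constructor
  · rw [R.eq_tr_add_tr hd c, map_add, ← R.tr_comp, ← R.tr_comp, htr]
    exact I.add_mem hki hj1
  · rw [R.eq_nm_mul_nm hd c, R.eq_nm_mul_nm hd 0, map_mul, map_mul]
    -- The factor of the norm of 0 at the orbit of `w` is 0, so only the norm of `c` remains, and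
    -- its factor at that orbit lies in `I`.
    simp only [← R.nm_comp, hnm, map_zero, zero_mul, sub_zero]
    exact I.mul_mem_right _ hki

variable (R)

/-- The Tambara ideal of all elements whose restrictions to all points lie in a given ideal of
the bottom level. -/
def pointIdeal (I : Ideal (R.obj (free G))) : TambaraIdeal R where
  carrier X := ⨅ x : free G →[G] X, I.comap (R.res x)
  res_mem f a ha := by
    simp only [Ideal.mem_iInf, Ideal.mem_comap] at ha ⊢
    intro x
    rw [← R.res_comp]
    exact ha _
  tr_mem {X Y} f a ha := by
    simp only [Ideal.mem_iInf, Ideal.mem_comap] at ha ⊢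
    intro y
    -- The pullback of `f` along the point `y` lies over the free orbit, and its points give points
    -- of `X`.
    rw [R.res_tr _ _ _ _ (pullback_isPullbackSquare f y)]
    refine (tr_nm_mem_of_free I _ _ _ _ rfl fun x => ?_).1
    rw [← R.res_comp]
    exact ha _
  nm_mem {X Y} f a ha := by
    simp only [Ideal.mem_iInf, Ideal.mem_comap] at ha ⊢
    intro y
    rw [map_sub, R.res_nm _ _ _ _ (pullback_isPullbackSquare f y),
      R.res_nm _ _ _ _ (pullback_isPullbackSquare f y), map_zero]
    refine (tr_nm_mem_of_free I _ _ _ _ rfl fun x => ?_).2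
    rw [← R.res_comp]
    exact ha _

/-- Containment in this ideal is tested at the bottom level, where its elements lie in `I`;
primality of `I` then applies to elements there. -/
theorem pointIdeal_isPrime (I : Ideal (R.obj (free G))) [hI : I.IsPrime] :
    (R.pointIdeal I).IsPrime := by
  have hmem : ∀ a ∈ (R.pointIdeal I).carrier (free G), a ∈ I := fun a ha => by
    have := Ideal.mem_iInf.1 ha (MulActionHom.id G)
    rwa [Ideal.mem_comap, R.res_id] at this
  constructor
  · intro h
    refine hI.ne_top ((Ideal.eq_top_iff_one I).2 (hmem 1 ?_))
    rw [h]
    exact Submodule.mem_top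
  · intro J K hJK
    have key : ∀ L : TambaraIdeal R, ¬ L ≤ R.pointIdeal I →
        ∃ a ∈ L.carrier (free G), a ∉ I := by
      intro L hL
      by_contra! hc
      exact hL fun X a ha => Ideal.mem_iInf.2 fun x => hc _ (L.res_mem x ha)
    by_contra! hc
    obtain ⟨a, ha, ha'⟩ := key J hc.1
    obtain ⟨b, hb, hb'⟩ := key K hc.2
    exact (hI.mem_or_mem (hmem _ (hJK _ (TambaraIdeal.mul_mem_mul ha hb)))).elim ha' hb'

end PointIdeal

/-! ### Contraction of primes from a subgroup. -/

section Contraction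

variable {G : Type u} [Group G] [Finite G] {R : TambaraFunctor.{u, v} G} {H : Subgroup G}

/-- The restriction of a Tambara ideal to a subgroup. -/
def TambaraIdeal.restrict (I : TambaraIdeal R) (H : Subgroup G) :
    TambaraIdeal (R.resFunctor H) where
  carrier X := I.carrier (induce H X)
  res_mem f _ ha := I.res_mem (induceMap H f) ha
  tr_mem f _ ha := I.tr_mem (induceMap H f) ha
  nm_mem f _ ha := I.nm_mem (induceMap H f) ha

/-- The unit `Y → (G ×_H Y)|_H`, `y ↦ [1, y]`. -/
def indUnit (Y : FinGSet H) : Y →[H] FinGSet.restrict H (induce H Y) where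
  toFun y := indMk (1 : G) y
  map_smul' h y := by
    change (indMk (1 : G) (h • y) : induce H Y) = (h : G) • indMk (1 : G) y
    rw [smul_indMk, indMk_eq]
    exact ⟨h⁻¹, by simp, by simp⟩

/-- A triangle identity: `G ×_H Y → G ×_H (G ×_H Y) → G ×_H Y`, induced unit followed by action, is
the identity. -/
theorem mem_of_mem_contraction {Q : TambaraIdeal (R.resFunctor H)} {Y : FinGSet H}
    {a : R.obj (induce H Y)}
    (ha : a ∈ (Q.coind.comap (R.coindUnit H)).carrier (induce H Y)) : a ∈ Q.carrier Y := by
  have h1 : R.res (actMap H (induce H Y)) a ∈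
      Q.carrier (FinGSet.restrict H (induce H Y)) := ha
  have h2 := Q.res_mem (indUnit Y) h1
  change R.res (induceMap H (indUnit Y)) (R.res (actMap H (induce H Y)) a) ∈ Q.carrier Y at h2
  rw [← R.res_comp] at h2
  have h3 : (actMap H (induce H Y)).comp (induceMap H (indUnit Y)) = MulActionHom.id G := by
    ext z
    obtain ⟨g, y, rfl⟩ := indMk_surj z
    change g • (indMk (1 : G) y : induce H Y) = indMk g y
    rw [smul_indMk, mul_one]
  rwa [h3, R.res_id] at h2

/-- The contraction of the coinduction of a prime ideal is prime. -/
theorem TambaraIdeal.IsPrime.contraction {Q : TambaraIdeal (R.resFunctor H)} (hQ : Q.IsPrime) :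
    (Q.coind.comap (R.coindUnit H)).IsPrime := by
  constructor
  · intro h
    refine hQ.1 (le_antisymm (fun _ _ _ => Submodule.mem_top) fun Y a _ =>
      mem_of_mem_contraction ?_)
    rw [h]
    exact Submodule.mem_top
  · intro I J hIJ
    have h1 : I.restrict H * J.restrict H ≤ Q := TambaraIdeal.mul_le fun Y a ha b hb =>
      mem_of_mem_contraction (hIJ _ (TambaraIdeal.mul_mem_mul (I := I) (J := J) ha hb))
    exact (hQ.2 _ _ h1).imp (fun h X a ha => h _ (I.res_mem (actMap H X) ha))
      (fun h X a ha => h _ (J.res_mem (actMap H X) ha))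

end Contraction

/-! ### The generic point and nonemptiness of strata. -/

section DomainLike

/-- If `R` is domain-like, then the zero ideal is a generic point of its spectrum. -/
theorem IsDomainLike.bot_mem_of_isOpen {G : Type u} [Group G]
    {R : TambaraFunctor.{u, v} G} (hR : R.IsDomainLike) {U : Set R.Spec}
    (hU : IsOpen U) (hne : U.Nonempty) : (⟨⊥, hR⟩ : R.Spec) ∈ U := by
  obtain ⟨P, hP⟩ := hne
  induction hU with
  | basic s hs =>
    obtain ⟨I, rfl⟩ := hs
    -- A subbasic open set that contains `P` is the complement of `V(I)` with `I` not below `P`;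
    -- such an `I` is not zero.
    intro h
    exact hP fun X a ha => by
      have h0 : a = 0 := h X ha
      rw [h0]
      exact zero_mem _
  | univ => trivial
  | inter s t _ _ h1 h2 => exact ⟨h1 hP.1, h2 hP.2⟩
  | sUnion S _ ih =>
    obtain ⟨s, hs, hPs⟩ := hP
    exact ⟨s, hs, ih s hs hPs⟩

variable {G : Type u} [Group G] [Finite G] {R : TambaraFunctor.{u, v} G}

/-- If 1 = 0 in `R(X)`, taking norms along the surjection `X → G/G` gives 1 = 0 in `R(G/G)`. By
restriction `R` is zero, so the zero ideal is not proper. -/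
theorem IsDomainLike.nontrivial (hR : R.IsDomainLike) (X : FinGSet G) [hX : Nonempty X] :
    Nontrivial (R.obj X) := by
  by_contra hc
  rw [not_nontrivial_iff_subsingleton] at hc
  have toPoint : ∀ Y : FinGSet G, ∃ f : Y →[G] orbit (⊤ : Subgroup G), True := fun Y =>
    ⟨⟨fun _ => (QuotientGroup.mk 1 : G ⧸ (⊤ : Subgroup G)), fun _ _ =>
      (QuotientGroup.subsingleton_quotient_top (G := G)).elim _ _⟩, trivial⟩
  obtain ⟨f, -⟩ := toPoint X
  have hf : Function.Surjective f := fun y =>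
    ⟨hX.some, (QuotientGroup.subsingleton_quotient_top (G := G)).elim _ _⟩
  have h0 : (1 : R.obj (orbit (⊤ : Subgroup G))) = 0 := by
    rw [← R.nm_zero_of_surjective hf, ← map_one (R.nm f), Subsingleton.elim (1 : R.obj X) 0]
  refine hR.1 (le_antisymm (fun _ _ _ => Submodule.mem_top) fun Y a _ => ?_)
  obtain ⟨k, -⟩ := toPoint Y
  have h1 : (1 : R.obj Y) = 0 := by rw [← map_one (R.res k), h0, map_zero]
  change a = 0
  rw [← mul_one a, h1, mul_zero]

theorem IsDomainLike.stratum_nonempty (hR : R.IsDomainLike) (H : Subgroup G) :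
    (R.stratum H).Nonempty := by
  have : Nonempty (induce H (free H)) := ⟨indMk (1 : G) (show free H from (1 : H))⟩
  have : Nontrivial ((R.resFunctor H).obj (free H)) := hR.nontrivial (induce H (free H))
  obtain ⟨I, hI⟩ := Ideal.exists_maximal ((R.resFunctor H).obj (free H))
  have := hI.isPrime
  have hQ := (R.resFunctor H).pointIdeal_isPrime I
  exact ⟨⟨_, hQ.contraction⟩, ⟨_, hQ⟩, rfl⟩

/-- The projection `G ×_H X → G/H`, `[g, x] ↦ gH`. -/
def indProj (H : Subgroup G) (X : FinGSet H) : induce H X →[G] orbit H where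
  toFun := Quotient.lift (fun a : G × X => (QuotientGroup.mk a.1 : G ⧸ H)) (by
    rintro ⟨a, x⟩ ⟨b, y⟩ ⟨h, h1, -⟩
    simp only at h1
    subst h1
    exact QuotientGroup.eq.2 (by simp))
  map_smul' g z := by
    obtain ⟨a, x, rfl⟩ := indMk_surj z
    rfl

theorem res_actMap_eq_zero {H : Subgroup G} {a : R.obj (orbit (⊤ : Subgroup G))}
    (ha : R.res (orbitMap (le_top : H ≤ ⊤)) a = 0) :
    R.res (actMap H (orbit (⊤ : Subgroup G))) a = 0 := by
  have h : actMap H (orbit (⊤ : Subgroup G)) =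
      (orbitMap (le_top : H ≤ ⊤)).comp (indProj H _) := by
    ext z
    exact (QuotientGroup.subsingleton_quotient_top (G := G)).elim _ _
  rw [h, R.res_comp, ha, map_zero]

end DomainLike

end TambaraFunctor

theorem mainTheorem10 {G : Type u} [Group G] [Finite G] (R : TambaraFunctor.{u, v} G)
    (hR : R.IsDomainLike) (H : Subgroup G)
    (hH : ¬ Function.Injective (R.res (FinGSet.orbitMap (le_top : H ≤ (⊤ : Subgroup G))))) :
    ¬ IsOpen (R.stratum H) := by
  intro hU
  obtain ⟨Q, hQ⟩ := hR.bot_mem_of_isOpen hU (hR.stratum_nonempty H)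
  refine hH ((injective_iff_map_eq_zero _).2 fun a ha => ?_)
  have h1 : a ∈ (Q.1.coind.comap (R.coindUnit H)).carrier _ := by
    change R.res (FinGSet.actMap H _) a ∈ Q.1.carrier _
    rw [TambaraFunctor.res_actMap_eq_zero ha]
    exact zero_mem _
  rw [← hQ] at h1
  exact h1
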